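/- Let $\mathcal X$ be a finite set, $\mathcal H_B$ a finite-dimensional complex Hilbert space, $p_X$ a probability mass function on $\mathcal X$ and, for each $x\in\mathcal X$, let $\rho_B^x$ be a density operator (positive semi-definite, unit trace) on $\mathcal H_B$. Consider the classical-quantum state $\rho_{XB}=\sum_{x}p_X(x)\,|x\rangle\langle x|\otimes\rho_B^x$ with marginals $\rho_X=\sum_x p_X(x)|x\rangle\langle x|$ and $\rho_B=\sum_x p_X(x)\rho_B^x$, and assume that $\rho_B$ is invertible. Let $\nu=|\mathrm{spec}(\rho_B)|$ be the number of distinct eigenvalues of $\rho_B$. For $0\le\eta\le1$ define the $\eta$-hypothesis testing information $$I_{\mathrm h}^{\eta}(X{:}B)_\rho:=\sup\bigl\{-\log\mathrm{Tr}[(\rho_X\otimes\rho_B)T]\;:\;0\le T\le \mathbb 1,\ \mathrm{Tr}[\rho_{XB}T]\ge 1-\eta\bigr\},$$ where $\log$ is the natural logarithm. For $0<\varepsilon<1$ define the minimal random codebook size for $\varepsilon$-covering $$M^\varepsilon(X{:}B)_\rho:=\min\Bigl\{M\in\{1,2,\dots\}\;:\;\tfrac12\,\mathbb E_{x_1,\dots,x_M}\Bigl\|\tfrac1M\sum_{m=1}^M\rho_B^{x_m}-\rho_B\Bigr\|_1\le\varepsilon\Bigr\},$$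 where $x_1,\dots,x_M$ are drawn independently from $p_X$ and $\|H\|_1=\mathrm{Tr}\sqrt{H^\dagger H}$. Theorem. For every $0<\varepsilon<1$ and all real $c,\delta$ with $0<c<\delta<\min\{\varepsilon/3,(1-\varepsilon)/2\}$, the set defining $M^\varepsilon(X{:}B)_\rho$ is non-empty and $$I_{\mathrm h}^{1-\varepsilon-2\delta}(X{:}B)_\rho-\log\frac{1+c}{c\delta}-\log\frac{\varepsilon+c}{\delta-c}\;\le\;\log M^\varepsilon(X{:}B)_\rho\;\le\;I_{\mathrm h}^{1-\varepsilon+3\delta}(X{:}B)_\rho+\log\frac{\nu^2}{\delta^4}.$$ -/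

import Mathlib

open scoped Matrix Kronecker ComplexOrder

noncomputable section

namespace SoftCovering

/-- A density operator on `ℂⁿ`: positive semidefinite with unit trace. -/
def IsDensity {n : Type*} [Fintype n] (ρ : Matrix n n ℂ) : Prop :=
  ρ.PosSemidef ∧ ρ.trace = 1

/-- The trace norm `‖H‖₁ = Tr √(H† H)`; the square root is taken by functional calculus. -/
def traceNorm {n : Type*} [Fintype n] [DecidableEq n] (H : Matrix n n ℂ) : ℝ :=
  (cfc Real.sqrt (Hᴴ * H)).trace.re

/-- The data of a classical-quantum state `∑ₓ p(x) |x⟩⟨x| ⊗ ρₓ`: a probability mass function `p`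
on the finite alphabet `X` and a density operator `ρₓ` on `ℂᴮ` for every letter `x`. -/
structure CQState (X B : Type*) [Fintype X] [Fintype B] where
  p : X → ℝ
  p_nonneg : ∀ x, 0 ≤ p x
  p_sum : ∑ x, p x = 1
  state : X → Matrix B B ℂ
  state_density : ∀ x, IsDensity (state x)

section Divergence

variable {n : Type*} [Fintype n] [DecidableEq n]

/-- A test (two-outcome measurement operator): `0 ≤ T ≤ 1` in the Loewner order. -/
def IsTest (T : Matrix n n ℂ) : Prop :=
  T.PosSemidef ∧ (1 - T).PosSemidef

/-- The `ε`-hypothesis testing divergence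
`D_h^ε(ρ‖σ) = sup { -log Tr[σ T] : 0 ≤ T ≤ 1, Tr[ρ T] ≥ 1 - ε }`, with natural logarithm and with
values in `[-∞, ∞]` (`-log 0 = ∞`). -/
def hypoDiv (ε : ℝ) (ρ σ : Matrix n n ℂ) : EReal :=
  ⨆ (T : Matrix n n ℂ) (_ : IsTest T ∧ 1 - ε ≤ (ρ * T).trace.re),
    -ENNReal.log (ENNReal.ofReal (σ * T).trace.re)

end Divergence

namespace CQState

variable {X B : Type*} [Fintype X] [Fintype B]

/-- The joint operator `ρ_XB = ∑ₓ p(x) |x⟩⟨x| ⊗ ρₓ`. -/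
def joint [DecidableEq X] (ρ : CQState X B) : Matrix (X × B) (X × B) ℂ :=
  ∑ x, (ρ.p x : ℂ) • (Matrix.single x x (1 : ℂ) ⊗ₖ ρ.state x)

/-- The marginal `ρ_X = ∑ₓ p(x) |x⟩⟨x|`. -/
def marginalX [DecidableEq X] (ρ : CQState X B) : Matrix X X ℂ :=
  ∑ x, (ρ.p x : ℂ) • Matrix.single x x (1 : ℂ)

/-- The marginal `ρ_B = ∑ₓ p(x) ρₓ`. -/
def marginalB (ρ : CQState X B) : Matrix B B ℂ :=
  ∑ x, (ρ.p x : ℂ) • ρ.state x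

/-- The `ε`-hypothesis testing information `I_h^ε(X:B)_ρ = D_h^ε(ρ_XB ‖ ρ_X ⊗ ρ_B)`. -/
def hypoInfo [DecidableEq X] [DecidableEq B] (ρ : CQState X B) (ε : ℝ) : EReal :=
  hypoDiv ε ρ.joint (ρ.marginalX ⊗ₖ ρ.marginalB)

/-- The state `(1/M) ∑ₘ ρ_{C(m)}` induced by the codebook `C` with `M` codewords. -/
def codebookState (ρ : CQState X B) {M : ℕ} (C : Fin M → X) : Matrix B B ℂ :=
  (M : ℂ)⁻¹ • ∑ m, ρ.state (C m)

/-- The expected covering error `½ 𝔼 ‖(1/M) ∑ₘ ρ_{C(m)} - ρ_B‖₁`, where the `M` codewords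
`C(1), …, C(M)` are drawn independently from `p`. -/
def coveringError [DecidableEq B] (ρ : CQState X B) (M : ℕ) : ℝ :=
  (1 / 2) * ∑ C : Fin M → X, (∏ m, ρ.p (C m)) * traceNorm (ρ.codebookState C - ρ.marginalB)

/-- The positive codebook sizes `M` for which the random codebook is an `ε`-covering. -/
def coveringSizes [DecidableEq B] (ρ : CQState X B) (ε : ℝ) : Set ℕ :=
  {M | 1 ≤ M ∧ ρ.coveringError M ≤ ε}

/-- The minimal random codebook size `M^ε(X:B)_ρ`. -/
def coveringNumber [DecidableEq B] (ρ : CQState X B) (ε : ℝ) : ℕ :=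
  sInf (ρ.coveringSizes ε)

/-- The number of distinct eigenvalues of `ρ_B`. -/
def specCard [DecidableEq B] (ρ : CQState X B) : ℕ :=
  (spectrum ℂ ρ.marginalB).ncard

end CQState

end SoftCovering

end

namespace SoftCovering

/-! ### Moments of sums of i.i.d. samples -/

section Sampling

variable {X : Type*} [Fintype X]

/-! Write `σ` for the marginal on `B` and `ν` for its number of eigenvalues.

Upper bound: fix a level `c`. For each letter, pinch `ρₓ` by the spectral projections of `σ` and let
`Qₓ` project onto the positive part of (pinched `ρₓ`) `- c σ`. Everything now commutes with `σ`, so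
`c Tr[σ Qₓ] ≤ Tr[ρₓ Qₓ]`, while the pinching inequality gives `(1 - Qₓ) ρₓ (1 - Qₓ) ≤ ν c σ`
(`exists_cutoff_projection`). Split `ρₓ = (1 - Qₓ) ρₓ + Qₓ ρₓ (1 - Qₓ) + Qₓ ρₓ Qₓ`. The last piece
costs only its mean trace `τ = 𝔼 Tr[ρₓ Qₓ]`; the first, and the adjoint of the second, have second
moment at most `ν c` in the form `Tr[Aᴴ σ⁻¹ D]`, so their empirical means fluctuate by order `√(ν c
/ M)` in trace norm (`coveringError_le`). Finally `c` is taken just above `exp I_h`: if `τ` exceeded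
`ε - 3δ`, the blocks `Qₓ` would form an admissible test beating `I_h`.

Lower bound: a test `T` with blocks `Tₓ` yields, for each codebook, a single test `L = S (S + a)⁻¹`
with `S = ∑ₘ T_{C(m)}`. It detects each codeword state almost as well as its own block, up to the
factor `1 + a`, yet `Tr[σ L] ≤ Tr[σ S] / a` (`exists_union_test`). If `M` is small, `L` separates
the codebook state from `σ`; averaging bounds the covering error from below
(`test_sub_le_coveringError`). -/

theorem sum_fin_succ_fun {E : Type*} [AddCommMonoid E] {M : ℕ} (F : (Fin (M + 1) → X) → E) :
    ∑ C, F C = ∑ x, ∑ C : Fin M → X, F (Fin.cons x C) := by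
  rw [← (Fin.consEquiv fun _ : Fin (M + 1) => X).sum_comp, Fintype.sum_prod_type]
  rfl

theorem sum_prod_weight {p : X → ℝ} (hp : ∑ x, p x = 1) (M : ℕ) :
    ∑ C : Fin M → X, ∏ m, p (C m) = 1 := by
  induction M with
  | zero => simp
  | succ M ih =>
    rw [sum_fin_succ_fun]
    simp [Fin.prod_univ_succ, ← Finset.mul_sum, ih, hp]

/-- The expectation of a sum of i.i.d. samples. -/
theorem expect_sum {E : Type*} [AddCommGroup E] [Module ℝ E] {p : X → ℝ} (hp : ∑ x, p x = 1)
    (g : X → E) (M : ℕ) :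
    ∑ C : Fin M → X, (∏ m, p (C m)) • ∑ m, g (C m) = (M : ℝ) • ∑ x, p x • g x := by
  induction M with
  | zero => simp
  | succ M ih =>
    rw [sum_fin_succ_fun]
    simp only [Fin.prod_univ_succ, Fin.sum_univ_succ, Fin.cons_zero, Fin.cons_succ, smul_add,
      Finset.sum_add_distrib, mul_smul]
    simp only [← Finset.smul_sum, ih, ← Finset.sum_smul, sum_prod_weight hp, hp]
    push_cast
    rw [add_smul, one_smul, add_comm]
    simp only [one_smul]

/-- The second moment of a sum of centred i.i.d. samples. -/
theorem expect_bilin_sum {E : Type*} [AddCommGroup E] [Module ℝ E] {p : X → ℝ}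
    (hp : ∑ x, p x = 1) (b : E →ₗ[ℝ] E →ₗ[ℝ] ℝ) (g : X → E) (hg : ∑ x, p x • g x = 0) (M : ℕ) :
    ∑ C : Fin M → X, (∏ m, p (C m)) * b (∑ m, g (C m)) (∑ m, g (C m))
      = M * ∑ x, p x * b (g x) (g x) := by
  induction M with
  | zero => simp
  | succ M ih =>
    have h0 := expect_sum hp g M
    rw [hg, smul_zero] at h0
    -- Centring makes the cross terms between the first sample and the remaining ones vanish, on
    -- either side of `b`; symmetry of `b` is not needed.
    have h1 : ∀ y : E, ∑ C : Fin M → X, (∏ m, p (C m)) * b y (∑ m, g (C m)) = 0 := fun y => by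
      have := congrArg (b y) h0
      simpa only [map_sum, map_smul, smul_eq_mul, map_zero] using this
    have h2 : ∀ y : E, ∑ C : Fin M → X, (∏ m, p (C m)) * b (∑ m, g (C m)) y = 0 := fun y => by
      have := congrArg (b.flip y) h0
      simpa only [map_sum, map_smul, smul_eq_mul, map_zero, LinearMap.flip_apply,
        LinearMap.sum_apply] using this
    rw [sum_fin_succ_fun]
    have h3 : ∀ x, ∑ C : Fin M → X, (∏ m, p ((Fin.cons x C : Fin (M + 1) → X) m)) *
        b (∑ m, g ((Fin.cons x C : Fin (M + 1) → X) m))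
          (∑ m, g ((Fin.cons x C : Fin (M + 1) → X) m))
        = p x * b (g x) (g x) + p x * (M * ∑ x, p x * b (g x) (g x)) := fun x => by
      rw [← ih, ← add_zero (p x * b (g x) (g x)), ← mul_zero (p x), ← h1 (g x),
        ← add_zero (p x * b (g x) (g x)), ← mul_zero (p x), ← h2 (g x)]
      nth_rewrite 1 [← mul_one (p x * b (g x) (g x)), ← sum_prod_weight hp M]
      simp only [Finset.mul_sum, ← Finset.sum_add_distrib]
      refine Finset.sum_congr rfl fun C _ => ?_
      simp only [Fin.prod_univ_succ, Fin.sum_univ_succ, Fin.cons_zero, Fin.cons_succ, map_add,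
        LinearMap.add_apply]
      ring
    simp only [h3, Finset.sum_add_distrib, ← Finset.sum_mul, hp]
    push_cast
    ring

/-- The variance of the empirical mean is at most the second moment divided by the number of
samples. -/
theorem expect_bilin_mean_sub_le {E : Type*} [AddCommGroup E] [Module ℝ E] {p : X → ℝ}
    (hp : ∑ x, p x = 1) (b : E →ₗ[ℝ] E →ₗ[ℝ] ℝ) (hb : ∀ y, 0 ≤ b y y)
    (V : X → E) {M : ℕ} (hM : 1 ≤ M) :
    ∑ C : Fin M → X, (∏ m, p (C m)) *
        b ((M : ℝ)⁻¹ • ∑ m, V (C m) - ∑ x, p x • V x) ((M : ℝ)⁻¹ • ∑ m, V (C m) - ∑ x, p x • V x)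
      ≤ (M : ℝ)⁻¹ * ∑ x, p x * b (V x) (V x) := by
  set e := ∑ x, p x • V x with he
  have hM0 : (M : ℝ) ≠ 0 := by positivity
  have hg : ∑ x, p x • (V x - e) = 0 := by
    simp only [smul_sub, Finset.sum_sub_distrib, ← Finset.sum_smul, hp, one_smul, ← he, sub_self]
  have h1 : ∀ C : Fin M → X, (M : ℝ)⁻¹ • ∑ m, V (C m) - e = (M : ℝ)⁻¹ • ∑ m, (V (C m) - e) := by
    intro C
    rw [Finset.sum_sub_distrib, smul_sub, Finset.sum_const, Finset.card_univ, Fintype.card_fin,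
      ← Nat.cast_smul_eq_nsmul ℝ, smul_smul, inv_mul_cancel₀ hM0, one_smul]
  have h2 := expect_bilin_sum hp b _ hg M
  have h3 : ∑ x, p x * b (V x - e) (V x - e) = ∑ x, p x * b (V x) (V x) - b e e := by
    have h4 : ∑ x, p x * b (V x) e = b e e := by
      have := congrArg (b.flip e) he
      simpa only [map_sum, map_smul, smul_eq_mul, LinearMap.flip_apply] using this.symm
    have h5 : ∑ x, p x * b e (V x) = b e e := by
      have := congrArg (b e) he
      simpa only [map_sum, map_smul, smul_eq_mul] using this.symm
    simp only [map_sub, LinearMap.sub_apply, mul_sub, Finset.sum_sub_distrib, h4, h5,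
      ← Finset.sum_mul, hp]
    ring
  calc _ = (M : ℝ)⁻¹ * (M : ℝ)⁻¹ * ∑ C : Fin M → X, (∏ m, p (C m)) *
        b (∑ m, (V (C m) - e)) (∑ m, (V (C m) - e)) := by
        rw [Finset.mul_sum]
        refine Finset.sum_congr rfl fun C _ => ?_
        rw [h1, map_smul, map_smul, LinearMap.smul_apply, smul_eq_mul, smul_eq_mul]
        ring
    _ = (M : ℝ)⁻¹ * (∑ x, p x * b (V x) (V x) - b e e) := by
        rw [h2, h3]; field_simp
    _ ≤ _ := by
        have := hb e
        gcongr
        linarith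

end Sampling

/-! ### Trace norm, spectral projections and pinching -/

section TraceNorm

variable {n : Type*} [Fintype n] [DecidableEq n]

theorem continuousOn_real_spectrum (f : ℝ → ℝ) (H : Matrix n n ℂ) :
    ContinuousOn f (spectrum ℝ H) :=
  Matrix.finite_real_spectrum.continuousOn f

theorem posSemidef_cfc {f : ℝ → ℝ} (hf : ∀ t, 0 ≤ f t) (H : Matrix n n ℂ) :
    (cfc f H).PosSemidef := by
  open scoped MatrixOrder in
  exact Matrix.nonneg_iff_posSemidef.1 (cfc_nonneg fun t _ => hf t)

theorem isHermitian_cfc (f : ℝ → ℝ) (H : Matrix n n ℂ) : (cfc f H).IsHermitian :=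
  cfc_predicate f H

theorem traceNorm_eq_cfc_abs {H : Matrix n n ℂ} (hH : H.IsHermitian) :
    traceNorm H = (cfc (fun t : ℝ => |t|) H).trace.re := by
  have ha : IsSelfAdjoint H := hH
  have h1 : Hᴴ * H = cfc (fun t : ℝ => t * t) H := by
    rw [cfc_mul _ _ H (continuousOn_real_spectrum _ H) (continuousOn_real_spectrum _ H),
      cfc_id' ℝ H ha, hH.eq]
  have h2 : (fun t : ℝ => |t|) = Real.sqrt ∘ fun t => t * t := by
    funext t; simp [Real.sqrt_mul_self_eq_abs]
  rw [traceNorm, h1, h2, cfc_comp Real.sqrt (fun t : ℝ => t * t) H ha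
    Real.continuous_sqrt.continuousOn (continuousOn_real_spectrum _ H)]

/-- The trace norm of a Hermitian matrix is attained by a Hermitian unitary. -/
theorem exists_sign {H : Matrix n n ℂ} (hH : H.IsHermitian) :
    ∃ U : Matrix n n ℂ, U.IsHermitian ∧ U * U = 1 ∧ traceNorm H = (U * H).trace.re := by
  have ha : IsSelfAdjoint H := hH
  -- The sign at `0` is taken to be `1`, so that `U * U = 1` even when `H` is singular.
  refine ⟨cfc (fun t : ℝ => if 0 ≤ t then 1 else -1) H, isHermitian_cfc _ H, ?_, ?_⟩
  · rw [← cfc_mul _ _ H (continuousOn_real_spectrum _ H) (continuousOn_real_spectrum _ H),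
      ← cfc_one ℝ H ha]
    congr 1
    funext t
    by_cases h : 0 ≤ t <;> simp [h]
  · rw [traceNorm_eq_cfc_abs hH]
    nth_rewrite 3 [← cfc_id' ℝ H ha]
    rw [← cfc_mul _ _ H (continuousOn_real_spectrum _ H) (continuousOn_real_spectrum _ H)]
    congr 4
    funext t
    by_cases h : 0 ≤ t
    · simp [h, abs_of_nonneg h]
    · simp [h, abs_of_neg (not_le.1 h)]

theorem trace_mul_re_nonneg {A C : Matrix n n ℂ} (hA : A.PosSemidef) (hC : C.PosSemidef) :
    0 ≤ (A * C).trace.re := by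
  obtain ⟨R, rfl⟩ : ∃ R : Matrix n n ℂ, A = Rᴴ * R := by
    open scoped MatrixOrder in
    simpa [Matrix.star_eq_conjTranspose] using
      CStarAlgebra.nonneg_iff_eq_star_mul_self.1 hA.nonneg
  rw [Matrix.mul_assoc, Matrix.trace_mul_comm]
  exact (Complex.nonneg_iff.1 (hC.mul_mul_conjTranspose_same R).trace_nonneg).1

/-- The left side is `Tr[L H] - Tr[(1 - L) H]`; pair `L` with `|H| - H ≥ 0` and `1 - L` with `|H| +
H ≥ 0`, then add. -/
theorem test_le_traceNorm {H L : Matrix n n ℂ} (hH : H.IsHermitian) (hL : IsTest L) :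
    2 * (L * H).trace.re - H.trace.re ≤ traceNorm H := by
  have ha : IsSelfAdjoint H := hH
  have h1 : (cfc (fun t : ℝ => |t|) H - H).PosSemidef := by
    nth_rewrite 2 [← cfc_id' ℝ H ha]
    rw [← cfc_sub _ _ H (continuousOn_real_spectrum _ H) (continuousOn_real_spectrum _ H)]
    exact posSemidef_cfc (fun t => sub_nonneg.2 (le_abs_self t)) H
  have h2 : (cfc (fun t : ℝ => |t|) H + H).PosSemidef := by
    nth_rewrite 2 [← cfc_id' ℝ H ha]
    rw [← cfc_add H _ _ (continuousOn_real_spectrum _ H) (continuousOn_real_spectrum _ H)]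
    exact posSemidef_cfc (fun t => by linarith [neg_abs_le t]) H
  have h3 := trace_mul_re_nonneg hL.1 h1
  have h4 := trace_mul_re_nonneg hL.2 h2
  rw [traceNorm_eq_cfc_abs hH]
  simp only [mul_sub, sub_mul, mul_add, one_mul, Matrix.trace_sub, Matrix.trace_add,
    Complex.sub_re, Complex.add_re] at h3 h4
  linarith

/-- The projection onto the positive part of a Hermitian matrix. -/
theorem exists_positive_projection {D : Matrix n n ℂ} (hD : D.IsHermitian) :
    ∃ Q : Matrix n n ℂ, Q.IsHermitian ∧ Q * Q = Q ∧ (Q * D).PosSemidef ∧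
      (-((1 - Q) * D)).PosSemidef ∧ ∀ A, Commute D A → Commute Q A := by
  have ha : IsSelfAdjoint D := hD
  have hc := fun f : ℝ → ℝ => continuousOn_real_spectrum f D
  refine ⟨cfc (fun t : ℝ => if 0 < t then 1 else 0) D, isHermitian_cfc _ D, ?_, ?_, ?_,
    fun A hA => hA.cfc_real _⟩
  · rw [← cfc_mul _ _ D (hc _) (hc _)]
    congr 1
    funext t
    by_cases h : 0 < t <;> simp [h]
  · nth_rewrite 2 [← cfc_id' ℝ D ha]
    rw [← cfc_mul _ _ D (hc _) (hc _)]
    refine posSemidef_cfc (fun t => ?_) D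
    by_cases h : 0 < t
    · simp [h, h.le]
    · simp [h]
  · nth_rewrite 2 [← cfc_id' ℝ D ha]
    rw [← cfc_one ℝ D ha, Pi.one_def, ← cfc_sub _ _ D (hc _) (hc _), ← cfc_mul _ _ D (hc _) (hc _),
      ← cfc_neg]
    refine posSemidef_cfc (fun t => ?_) D
    by_cases h : 0 < t
    · simp [h]
    · simp [h, not_lt.1 h]

/-- The spectral projections of a Hermitian matrix, one for each eigenvalue. -/
theorem exists_spectral_projections {S : Matrix n n ℂ} (hS : S.IsHermitian) :
    ∃ (s : Finset ℝ) (P : ℝ → Matrix n n ℂ), s.card = (spectrum ℂ S).ncard ∧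
      (∀ i, (P i).IsHermitian) ∧ (∀ i, P i * P i = P i) ∧ (∀ i j, i ≠ j → P i * P j = 0) ∧
      ∑ i ∈ s, P i = 1 ∧ (∀ i, P i * S = (i : ℂ) • P i) ∧ ∀ i, S * P i = (i : ℂ) • P i := by
  have ha : IsSelfAdjoint S := hS
  have hc := fun f : ℝ → ℝ => continuousOn_real_spectrum f S
  have hfin : (spectrum ℝ S).Finite := Matrix.finite_real_spectrum
  refine ⟨hfin.toFinset, fun i => cfc (fun t : ℝ => if t = i then 1 else 0) S, ?_,
    fun i => isHermitian_cfc _ S, fun i => ?_, fun i j hij => ?_, ?_, fun i => ?_, fun i => ?_⟩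
  · rw [← Set.ncard_eq_toFinset_card _ hfin, hS.spectrum_eq_image_range,
      hS.spectrum_real_eq_range_eigenvalues]
    exact (Set.ncard_image_of_injective _ Complex.ofReal_injective).symm
  · rw [← cfc_mul _ _ S (hc _) (hc _)]
    congr 1
    funext t
    by_cases h : t = i <;> simp [h]
  · rw [← cfc_mul _ _ S (hc _) (hc _), ← cfc_zero ℝ S]
    congr 1
    funext t
    by_cases h : t = i
    · simp [h, hij]
    · simp [h]
  · rw [← cfc_sum _ S _ (fun i _ => hc _), ← cfc_one ℝ S ha]
    refine cfc_congr fun t ht => ?_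
    simp [Finset.sum_apply, ht]
  · nth_rewrite 2 [← cfc_id' ℝ S ha]
    rw [← cfc_mul _ _ S (hc _) (hc _), Complex.coe_smul, ← cfc_smul i _ S (hc _)]
    congr 1
    funext t
    by_cases h : t = i <;> simp [h]
  · nth_rewrite 1 [← cfc_id' ℝ S ha]
    rw [← cfc_mul _ _ S (hc _) (hc _), Complex.coe_smul, ← cfc_smul i _ S (hc _)]
    congr 1
    funext t
    by_cases h : t = i <;> simp [h]

/-- The pinching inequality. -/
theorem pinching_inequality {ι : Type*} (s : Finset ι) (P : ι → Matrix n n ℂ)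
    (hP : ∀ i, (P i).IsHermitian) (h1 : ∑ i ∈ s, P i = 1) {A : Matrix n n ℂ} (hA : A.PosSemidef) :
    ((s.card : ℂ) • ∑ i ∈ s, P i * A * P i - A).PosSemidef := by
  -- A Lagrange-type identity: the cross terms resum to `A` because the `P i` sum to `1`.
  have key : (s.card : ℂ) • ∑ i ∈ s, P i * A * P i - A
      = (2⁻¹ : ℂ) • ∑ i ∈ s, ∑ j ∈ s, (P i - P j) * A * (P i - P j)ᴴ := by
    have e1 : A = ∑ i ∈ s, ∑ j ∈ s, P i * A * P j := by
      simp only [← Finset.mul_sum, h1, mul_one, ← Finset.sum_mul, one_mul]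
    have e2 : ∑ i ∈ s, ∑ j ∈ s, P j * A * P i = A := by
      rw [Finset.sum_comm]; exact e1.symm
    have : ∀ i j, (P i - P j) * A * (P i - P j)ᴴ
        = P i * A * P i - P i * A * P j - P j * A * P i + P j * A * P j := fun i j => by
      rw [((hP i).sub (hP j)).eq]; noncomm_ring
    simp only [this, Finset.sum_add_distrib, Finset.sum_sub_distrib, ← e1, e2, Finset.sum_const,
      ← Finset.smul_sum, ← Nat.cast_smul_eq_nsmul ℂ]
    module
  rw [key]
  refine Matrix.PosSemidef.smul ?_ (inv_nonneg.2 zero_le_two)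
  exact Matrix.posSemidef_sum _ fun i _ => Matrix.posSemidef_sum _ fun j _ =>
    hA.mul_mul_conjTranspose_same _

end TraceNorm

/-! ### Cutoff projections and the trace form weighted by an inverse state -/

section Pinching

variable {n : Type*} [Fintype n] [DecidableEq n]

theorem trace_re_nonneg {m : Type*} [Fintype m] {A : Matrix m m ℂ} (hA : A.PosSemidef) : 0 ≤ A.trace.re :=
  (Complex.nonneg_iff.1 hA.trace_nonneg).1

/-- A projection `Q` cutting off the part of `ρ` that is large relative to `S`: the trace of `Q`
against `S` is small, and the complementary corner of `ρ` is dominated by `S`. -/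
theorem exists_cutoff_projection {S ρ : Matrix n n ℂ} (hS : S.PosSemidef) (hρ : ρ.PosSemidef)
    {c : ℝ} (hc : 0 ≤ c) :
    ∃ Q : Matrix n n ℂ, Q.IsHermitian ∧ Q * Q = Q ∧ c * (S * Q).trace.re ≤ (ρ * Q).trace.re ∧
      ((((spectrum ℂ S).ncard * c : ℝ) : ℂ) • S - (1 - Q) * ρ * (1 - Q)).PosSemidef := by
  obtain ⟨s, P, hcard, hPh, hPP, hPP0, hP1, hPS, hSP⟩ := exists_spectral_projections hS.1
  -- The pinched state commutes with every `P i`, hence with `S`; so does the positive-part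
  -- projection of `A - c S`.
  set A := ∑ i ∈ s, P i * ρ * P i with hA
  have hAh : A.IsHermitian := by
    refine (Matrix.posSemidef_sum s fun i _ => ?_).1
    have := hρ.mul_mul_conjTranspose_same (P i)
    rwa [(hPh i).eq] at this
  have hcS : ((c : ℂ) • S).IsHermitian := hS.1.smul (by simp [isSelfAdjoint_iff])
  obtain ⟨Q, hQh, hQQ, hQD, hQD', hcomm⟩ := exists_positive_projection (hAh.sub hcS)
  have hAP : ∀ j ∈ s, Commute A (P j) := fun j hj => by
    have h1 : A * P j = P j * ρ * P j := by
      rw [hA, Finset.sum_mul, Finset.sum_eq_single_of_mem j hj, mul_assoc _ (P j), hPP]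
      intro i _ hij
      rw [mul_assoc _ (P i), hPP0 _ _ hij, mul_zero]
    have h2 : P j * A = P j * ρ * P j := by
      rw [hA, Finset.mul_sum, Finset.sum_eq_single_of_mem j hj, ← mul_assoc, ← mul_assoc, hPP]
      intro i _ hij
      rw [← mul_assoc, ← mul_assoc, hPP0 _ _ hij.symm, zero_mul, zero_mul]
    exact h1.trans h2.symm
  have hSPc : ∀ j, Commute S (P j) := fun j => (hSP j).trans (hPS j).symm
  have hSsum : S = ∑ i ∈ s, (i : ℂ) • P i := by
    rw [← mul_one S, ← hP1, Finset.mul_sum]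
    exact Finset.sum_congr rfl fun i _ => hSP i
  have hAS : Commute A S := by
    rw [hSsum]
    exact Commute.sum_right _ _ _ fun j hj => (hAP j hj).smul_right _
  have hQP : ∀ j ∈ s, Commute Q (P j) := fun j hj =>
    hcomm _ ((hAP j hj).sub_left ((hSPc j).smul_left _))
  have hQS : Commute Q S := hcomm _ (hAS.sub_left ((Commute.refl S).smul_left _))
  have hQA : Commute Q A :=
    hcomm _ ((Commute.refl A).sub_left (hAS.symm.smul_left _))
  have hPSD : ∀ (B : Matrix n n ℂ), B.IsHermitian → (B * ρ * B).PosSemidef := fun B hB => by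
    have := hρ.mul_mul_conjTranspose_same B
    rwa [hB.eq] at this
  refine ⟨Q, hQh, hQQ, ?_, ?_⟩
  · have h1 := trace_re_nonneg hQD
    have h2 : (Q * A).trace = (ρ * Q).trace := by
      rw [hA, Finset.mul_sum, Matrix.trace_sum]
      have : ∀ i ∈ s, (Q * (P i * ρ * P i)).trace = (P i * (ρ * Q)).trace := fun i hi => by
        rw [Matrix.trace_mul_comm, mul_assoc (P i * ρ), ← (hQP i hi).eq, ← mul_assoc,
          Matrix.trace_mul_comm, ← mul_assoc, ← mul_assoc, hPP, mul_assoc]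
      rw [Finset.sum_congr rfl this, ← Matrix.trace_sum, ← Finset.sum_mul, hP1, one_mul]
    rw [mul_sub, Matrix.trace_sub, h2, Matrix.mul_smul, Matrix.trace_smul, Complex.sub_re,
      smul_eq_mul, Complex.re_ofReal_mul, Matrix.trace_mul_comm Q S] at h1
    linarith
  · have hRh : (1 - Q).IsHermitian := Matrix.isHermitian_one.sub hQh
    have h1 := pinching_inequality s P hPh hP1 (hPSD _ hRh)
    -- As `Q` commutes with each `P i`, pinching the corner of `ρ` gives the corner of `A`.
    have h2 : ∑ i ∈ s, P i * ((1 - Q) * ρ * (1 - Q)) * P i = (1 - Q) * A := by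
      have hRR : (1 - Q) * (1 - Q) = 1 - Q := by
        rw [mul_sub, sub_mul, sub_mul, hQQ]; simp
      have hRA : Commute (1 - Q) A := (Commute.one_left A).sub_left hQA
      have e : ∀ i ∈ s, P i * ((1 - Q) * ρ * (1 - Q)) * P i
          = (1 - Q) * (P i * ρ * P i) * (1 - Q) := fun i hi => by
        have hc' : Commute (1 - Q) (P i) := (Commute.one_left _).sub_left (hQP i hi)
        simp only [← mul_assoc, ← hc'.eq]
        simp only [mul_assoc, hc'.eq]
      rw [Finset.sum_congr rfl e, ← Finset.sum_mul, ← Finset.mul_sum, ← hA, mul_assoc, ← hRA.eq,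
        ← mul_assoc, hRR]
    have h3 : (Q * S).PosSemidef := by
      have := hS.mul_mul_conjTranspose_same Q
      rwa [hQh.eq, mul_assoc, ← hQS.eq, ← mul_assoc, hQQ] at this
    rw [h2, hcard] at h1
    -- Uses `c S - (1 - Q) A = c Q S - (1 - Q)(A - c S)`, both summands being positive.
    have h4 := h1.add (((h3.smul (Complex.zero_le_real.2 hc)).add hQD').smul
      (Nat.cast_nonneg (spectrum ℂ S).ncard : (0 : ℂ) ≤ _))
    convert h4 using 1
    push_cast
    simp only [sub_mul, mul_sub, one_mul, smul_sub, smul_add, Matrix.mul_smul, smul_neg, smul_smul,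
      mul_one]
    abel

/-- Both matrices are Schur complements of the block matrix with rows `(S, F)` and `(Fᴴ, k)`, so
each is positive exactly when the block matrix is. -/
theorem posSemidef_schur_swap {S F : Matrix n n ℂ} (hS : S.PosDef) {k : ℝ} (hk : 0 < k)
    (h : ((k : ℂ) • S - F * Fᴴ).PosSemidef) : ((k : ℂ) • 1 - Fᴴ * S⁻¹ * F).PosSemidef := by
  have hk0 : (k : ℂ) ≠ 0 := by exact_mod_cast hk.ne'
  have hk1 : (0 : ℂ) < k := by exact_mod_cast hk
  have hD : ((k : ℂ) • (1 : Matrix n n ℂ)).PosDef := Matrix.PosDef.one.smul hk1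
  have := hS.isUnit.invertible
  have := hD.isUnit.invertible
  rw [← Matrix.PosDef.fromBlocks₁₁ F _ hS, Matrix.PosDef.fromBlocks₂₂ S F hD]
  have e : ((k : ℂ) • (1 : Matrix n n ℂ))⁻¹ = (k : ℂ)⁻¹ • 1 :=
    Matrix.inv_eq_left_inv (by
      rw [Matrix.smul_mul, Matrix.mul_smul, one_mul, smul_smul, inv_mul_cancel₀ hk0, one_smul])
  have h' := h.smul (inv_nonneg.2 hk1.le)
  rw [smul_sub, smul_smul, inv_mul_cancel₀ hk0, one_smul] at h'
  rwa [e, Matrix.mul_smul, mul_one, Matrix.smul_mul]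

/-- The real bilinear form `(A, D) ↦ Re Tr[Aᴴ W D]`. -/
noncomputable def traceForm (W : Matrix n n ℂ) : Matrix n n ℂ →ₗ[ℝ] Matrix n n ℂ →ₗ[ℝ] ℝ :=
  LinearMap.mk₂ ℝ (fun A D => (Aᴴ * W * D).trace.re)
    (fun A A' D => by simp [add_mul])
    (fun r A D => by simp)
    (fun A D D' => by simp [mul_add])
    (fun r A D => by simp)

theorem traceForm_apply (W A D : Matrix n n ℂ) : traceForm W A D = (Aᴴ * W * D).trace.re := rfl

theorem traceForm_self_nonneg {W : Matrix n n ℂ} (hW : W.PosSemidef) (A : Matrix n n ℂ) :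
    0 ≤ traceForm W A A :=
  trace_re_nonneg (hW.conjTranspose_mul_mul_same A)

theorem traceForm_le_of_dominated {S F : Matrix n n ℂ} (hS : S.PosDef) {k : ℝ} (hk : 0 < k)
    (h : ((k : ℂ) • S - F * Fᴴ).PosSemidef) (N : Matrix n n ℂ) :
    traceForm S⁻¹ (F * N) (F * N) ≤ k * (Nᴴ * N).trace.re := by
  have := trace_re_nonneg ((posSemidef_schur_swap hS hk h).conjTranspose_mul_mul_same N)
  rw [mul_sub, sub_mul, Matrix.trace_sub, Matrix.mul_smul, mul_one, Matrix.smul_mul,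
    Matrix.trace_smul, Complex.sub_re, smul_eq_mul, Complex.re_ofReal_mul] at this
  rw [traceForm_apply, Matrix.conjTranspose_mul]
  simp only [mul_assoc] at this ⊢
  linarith

/-- A weighted Young inequality for the trace pairing with a Hermitian unitary. -/
theorem trace_unitary_mul_le {S U : Matrix n n ℂ} (hS : S.PosDef) (hS1 : S.trace = 1)
    (hU : U.IsHermitian) (hUU : U * U = 1) (t : ℝ) (D : Matrix n n ℂ) :
    2 * t * (U * D).trace.re ≤ t ^ 2 + traceForm S⁻¹ D D := by
  have hinv : S * S⁻¹ = 1 := Matrix.mul_nonsing_inv _ ((Matrix.isUnit_iff_isUnit_det _).1 hS.isUnit)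
  have hinv' : S⁻¹ * S = 1 := Matrix.nonsing_inv_mul _ ((Matrix.isUnit_iff_isUnit_det _).1 hS.isUnit)
  -- Complete the square around `t S U`; the vector `S U` has unit length in this form since `Tr[U S
  -- U] = Tr S = 1`.
  have h := traceForm_self_nonneg hS.inv.posSemidef (t • (S * U) - D)
  have h1 : traceForm S⁻¹ (S * U) (S * U) = 1 := by
    rw [traceForm_apply, Matrix.conjTranspose_mul, hU.eq, hS.1.eq, mul_assoc U, hinv, mul_one,
      Matrix.trace_mul_comm, mul_assoc, hUU, mul_one, hS1,
      Complex.one_re]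
  have h2 : traceForm S⁻¹ (S * U) D = (U * D).trace.re := by
    rw [traceForm_apply, Matrix.conjTranspose_mul, hU.eq, hS.1.eq, mul_assoc U, hinv, mul_one]
  have h3 : traceForm S⁻¹ D (S * U) = (U * D).trace.re := by
    rw [traceForm_apply, mul_assoc, ← mul_assoc S⁻¹, hinv', one_mul]
    have := congrArg Complex.re (Matrix.trace_conjTranspose (U * D))
    rwa [Matrix.conjTranspose_mul, hU.eq, Complex.star_def, Complex.conj_re] at this
  simp only [map_sub, map_smul, LinearMap.sub_apply, LinearMap.smul_apply, smul_eq_mul, h1, h2,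
    h3] at h
  linarith

/-- `(1 ± U)² = 2 (1 ± U)`, so `-1 ≤ U ≤ 1`. This controls the cut-off piece without any variance
estimate. -/
theorem trace_unitary_mul_posSemidef_le {U A : Matrix n n ℂ} (hU : U.IsHermitian)
    (hUU : U * U = 1) (hA : A.PosSemidef) : |(U * A).trace.re| ≤ A.trace.re := by
  have h1 : ((1 - U) * (1 - U)) = (2 : ℂ) • (1 - U) := by
    rw [sub_mul, mul_sub, one_mul, mul_sub, hUU, mul_one, one_mul]; module
  have h2 : ((1 + U) * (1 + U)) = (2 : ℂ) • (1 + U) := by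
    rw [add_mul, mul_add, one_mul, mul_add, hUU, mul_one, one_mul]; module
  have g1 : ((2 : ℂ) • (1 - U)).PosSemidef := by
    have := Matrix.posSemidef_conjTranspose_mul_self (1 - U)
    rwa [(Matrix.isHermitian_one.sub hU).eq, h1] at this
  have g2 : ((2 : ℂ) • (1 + U)).PosSemidef := by
    have := Matrix.posSemidef_conjTranspose_mul_self (1 + U)
    rwa [(Matrix.isHermitian_one.add hU).eq, h2] at this
  have k1 := trace_mul_re_nonneg g1 hA
  have k2 := trace_mul_re_nonneg g2 hA
  simp [sub_mul, add_mul, smul_sub, smul_add] at k1 k2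
  rw [abs_le]
  constructor <;> linarith

end Pinching

/-! ### Block-diagonal tests on the classical-quantum system -/

section Blocks

variable {X B : Type*} [Fintype X] [Fintype B] [DecidableEq X]

/-- The diagonal block at `x` of a matrix indexed by `X × B`. -/
def diagBlock {X B : Type*} (T : Matrix (X × B) (X × B) ℂ) (x : X) : Matrix B B ℂ :=
  T.submatrix (Prod.mk x) (Prod.mk x)

theorem trace_single_kronecker_mul (x : X) (A : Matrix B B ℂ) (T : Matrix (X × B) (X × B) ℂ) :
    ((Matrix.single x x (1 : ℂ) ⊗ₖ A) * T).trace = (A * diagBlock T x).trace := by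
  simp only [Matrix.trace, Matrix.diag, Matrix.mul_apply, Fintype.sum_prod_type,
    Matrix.kroneckerMap_apply, diagBlock, Matrix.submatrix_apply]
  rw [Finset.sum_eq_single x]
  · refine Finset.sum_congr rfl fun b _ => ?_
    rw [Finset.sum_eq_single x]
    · simp
    · intro y _ hy
      simp [hy.symm]
    · simp
  · intro y _ hy
    simp [hy.symm]
  · simp

theorem trace_joint_mul (ρ : CQState X B) (T : Matrix (X × B) (X × B) ℂ) :
    (ρ.joint * T).trace.re = ∑ x, ρ.p x * (ρ.state x * diagBlock T x).trace.re := by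
  simp only [CQState.joint, Finset.sum_mul, Matrix.trace_sum, Matrix.smul_mul, Matrix.trace_smul,
    trace_single_kronecker_mul, Complex.re_sum, smul_eq_mul, Complex.re_ofReal_mul]

theorem trace_product_mul (ρ : CQState X B) (T : Matrix (X × B) (X × B) ℂ) :
    ((ρ.marginalX ⊗ₖ ρ.marginalB) * T).trace.re
      = ∑ x, ρ.p x * (ρ.marginalB * diagBlock T x).trace.re := by
  have h : ρ.marginalX ⊗ₖ ρ.marginalB
      = ∑ x, (ρ.p x : ℂ) • (Matrix.single x x (1 : ℂ) ⊗ₖ ρ.marginalB) := by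
    ext i j
    simp only [CQState.marginalX, Matrix.sum_apply, Matrix.kroneckerMap_apply, Matrix.smul_apply,
      Finset.sum_mul, smul_eq_mul, mul_assoc]
  simp only [h, Finset.sum_mul, Matrix.trace_sum, Matrix.smul_mul, Matrix.trace_smul,
    trace_single_kronecker_mul, Complex.re_sum, smul_eq_mul, Complex.re_ofReal_mul]

variable [DecidableEq B]

theorem isTest_diagBlock {X B : Type*} [Fintype X] [Fintype B] [DecidableEq X] [DecidableEq B]
    {T : Matrix (X × B) (X × B) ℂ} (hT : IsTest T) (x : X) :
    IsTest (diagBlock T x) := by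
  refine ⟨hT.1.submatrix _, ?_⟩
  have := hT.2.submatrix (Prod.mk x)
  have h1 : (1 : Matrix (X × B) (X × B) ℂ).submatrix (Prod.mk x) (Prod.mk x) = 1 :=
    Matrix.submatrix_one _ (Prod.mk_right_injective x)
  rw [← h1]
  exact this

theorem isTest_of_projection {Q : Matrix B B ℂ} (hQ : Q.IsHermitian) (hQQ : Q * Q = Q) :
    IsTest Q := by
  constructor
  · have := Matrix.posSemidef_conjTranspose_mul_self Q
    rwa [hQ.eq, hQQ] at this
  · have := Matrix.posSemidef_conjTranspose_mul_self (1 - Q)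
    rwa [(Matrix.isHermitian_one.sub hQ).eq, mul_sub, sub_mul, sub_mul, hQQ, one_mul, mul_one,
      one_mul, sub_self, sub_zero] at this

/-- Tests on `B` controlled by the letter `x` assemble to a test on `X × B`. -/
theorem exists_isTest_diagBlock {Q : X → Matrix B B ℂ} (hQ : ∀ x, IsTest (Q x)) :
    ∃ T : Matrix (X × B) (X × B) ℂ, IsTest T ∧ ∀ x, diagBlock T x = Q x := by
  have hs : ∀ x : X, (Matrix.single x x (1 : ℂ)).PosSemidef := fun x => by
    have := Matrix.posSemidef_conjTranspose_mul_self (Matrix.single x x (1 : ℂ))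
    simpa using this
  refine ⟨∑ x, Matrix.single x x (1 : ℂ) ⊗ₖ Q x, ⟨?_, ?_⟩, fun x => ?_⟩
  · exact Matrix.posSemidef_sum _ fun x _ => (hs x).kronecker (hQ x).1
  · have : (1 : Matrix (X × B) (X × B) ℂ) - ∑ x, Matrix.single x x (1 : ℂ) ⊗ₖ Q x
        = ∑ x, Matrix.single x x (1 : ℂ) ⊗ₖ (1 - Q x) := by
      have h1 : (1 : Matrix (X × B) (X × B) ℂ)
          = ∑ x : X, Matrix.single x x (1 : ℂ) ⊗ₖ (1 : Matrix B B ℂ) := by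
        ext ⟨x, a⟩ ⟨y, b⟩
        by_cases hxy : x = y
        · subst hxy
          simp [Matrix.sum_apply, Matrix.single_apply, Matrix.one_apply]
        · have : ∀ z, ¬ (z = x ∧ z = y) := fun z hz => hxy (hz.1.symm.trans hz.2)
          simp [Matrix.sum_apply, Matrix.one_apply, hxy, this]
      rw [h1, ← Finset.sum_sub_distrib]
      refine Finset.sum_congr rfl fun x _ => ?_
      ext i j
      simp [mul_sub]
    rw [this]
    exact Matrix.posSemidef_sum _ fun x _ => (hs x).kronecker (hQ x).2
  · ext a b
    simp [diagBlock, Matrix.sum_apply, Matrix.single_apply]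

end Blocks

/-! ### Second-moment bound on the covering error -/

section Covering

variable {X B : Type*} [Fintype X] [Fintype B]

/-- The deviation of the empirical mean of `V` along the codebook `C` from its expectation. -/
noncomputable def deviation {E : Type*} [AddCommGroup E] [Module ℝ E] (p : X → ℝ) (V : X → E)
    {M : ℕ} (C : Fin M → X) : E :=
  (M : ℝ)⁻¹ • ∑ m, V (C m) - ∑ x, p x • V x

theorem codebookState_sub_marginalB (ρ : CQState X B) {M : ℕ} (C : Fin M → X) :
    ρ.codebookState C - ρ.marginalB = deviation ρ.p ρ.state C := by
  rw [deviation, CQState.codebookState, CQState.marginalB]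
  congr 1
  · rw [← Complex.coe_smul]; simp

theorem posSemidef_marginalB (ρ : CQState X B) : ρ.marginalB.PosSemidef :=
  Matrix.posSemidef_sum _ fun x _ =>
    (ρ.state_density x).1.smul (Complex.zero_le_real.2 (ρ.p_nonneg x))

theorem isHermitian_codebookState_sub_marginalB (ρ : CQState X B) {M : ℕ} (C : Fin M → X) :
    (ρ.codebookState C - ρ.marginalB).IsHermitian :=
  ((Matrix.posSemidef_sum _ fun m _ => (ρ.state_density (C m)).1).1.smul
    (by simp [isSelfAdjoint_iff])).sub (posSemidef_marginalB ρ).1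

theorem trace_marginalB (ρ : CQState X B) : ρ.marginalB.trace = 1 := by
  simp only [CQState.marginalB, Matrix.trace_sum, Matrix.trace_smul, (ρ.state_density _).2,
    smul_eq_mul, mul_one]
  exact_mod_cast ρ.p_sum

theorem prod_weight_nonneg (ρ : CQState X B) {M : ℕ} (C : Fin M → X) : 0 ≤ ∏ m, ρ.p (C m) :=
  Finset.prod_nonneg fun _ _ => ρ.p_nonneg _

variable [DecidableEq B]

theorem exists_mul_conjTranspose {A : Matrix B B ℂ} (hA : A.PosSemidef) :
    ∃ R : Matrix B B ℂ, A = R * Rᴴ := by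
  open scoped MatrixOrder in
  obtain ⟨R, hR⟩ := CStarAlgebra.nonneg_iff_eq_star_mul_self.1 hA.nonneg
  exact ⟨Rᴴ, by simpa [Matrix.star_eq_conjTranspose] using hR⟩

/-- The covering error is bounded by the weight cut off by the projections `Q x` plus a variance
term. -/
theorem coveringError_le (ρ : CQState X B) (hB : ρ.marginalB.PosDef) (Q : X → Matrix B B ℂ)
    (hQh : ∀ x, (Q x).IsHermitian) (hQQ : ∀ x, Q x * Q x = Q x) {k : ℝ} (hk : 0 < k)
    (hdom : ∀ x, ((k : ℂ) • ρ.marginalB - (1 - Q x) * ρ.state x * (1 - Q x)).PosSemidef)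
    {t : ℝ} (ht : 0 < t) {M : ℕ} (hM : 1 ≤ M) :
    ρ.coveringError M
      ≤ ∑ x, ρ.p x * (ρ.state x * Q x).trace.re + (t + k / (t * M)) / 2 := by
  set V₁ : X → Matrix B B ℂ := fun x => (1 - Q x) * ρ.state x with hV₁
  set V₂ : X → Matrix B B ℂ := fun x => (1 - Q x) * ρ.state x * Q x with hV₂
  set V₃ : X → Matrix B B ℂ := fun x => Q x * ρ.state x * Q x with hV₃
  set σ := ρ.marginalB with hσ
  have hρ := fun x => (ρ.state_density x).1
  have htest := fun x => isTest_of_projection (hQh x) (hQQ x)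
  have htr : ∀ x, (ρ.state x).trace.re = 1 := fun x => by rw [(ρ.state_density x).2]; rfl
  have hdec : ∀ x, ρ.state x = V₁ x + (V₂ x)ᴴ + V₃ x := fun x => by
    simp only [hV₁, hV₂, hV₃, Matrix.conjTranspose_mul, Matrix.conjTranspose_sub,
      Matrix.conjTranspose_one, (hQh x).eq, (hρ x).1.eq]
    noncomm_ring
  have hV₃p : ∀ x, (V₃ x).PosSemidef := fun x => by
    have := (hρ x).mul_mul_conjTranspose_same (Q x)
    rwa [(hQh x).eq] at this
  have hV₃t : ∀ x, (V₃ x).trace = (ρ.state x * Q x).trace := fun x => by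
    simp only [hV₃]
    rw [Matrix.trace_mul_comm, ← mul_assoc, hQQ, Matrix.trace_mul_comm]
  -- With `ρₓ = R Rᴴ` and `F = (1 - Qₓ) R`, one has `V₁ = F Rᴴ` and `V₂ = F (Rᴴ Qₓ)`; the right
  -- factors contribute `Tr ρₓ = 1` and `Tr[ρₓ Qₓ] ≤ 1`.
  have hform : ∀ x, traceForm σ⁻¹ (V₁ x) (V₁ x) ≤ k ∧ traceForm σ⁻¹ (V₂ x) (V₂ x) ≤ k := by
    intro x
    obtain ⟨R, hR⟩ := exists_mul_conjTranspose (hρ x)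
    have hd : ((k : ℂ) • σ - ((1 - Q x) * R) * ((1 - Q x) * R)ᴴ).PosSemidef := by
      have := hdom x
      rw [hR] at this
      rw [Matrix.conjTranspose_mul, (Matrix.isHermitian_one.sub (hQh x)).eq]
      simpa only [mul_assoc] using this
    constructor
    · have := traceForm_le_of_dominated hB hk hd Rᴴ
      rwa [Matrix.conjTranspose_conjTranspose, ← hR, htr, mul_one, mul_assoc, ← hR] at this
    · have := traceForm_le_of_dominated hB hk hd (Rᴴ * Q x)
      rw [Matrix.conjTranspose_mul, Matrix.conjTranspose_conjTranspose, (hQh x).eq] at this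
      have e1 : (1 - Q x) * R * (Rᴴ * Q x) = V₂ x := by
        simp only [hV₂, hR, mul_assoc]
      have e2 : Q x * R * (Rᴴ * Q x) = V₃ x := by
        simp only [hV₃, hR, mul_assoc]
      rw [e1, e2, hV₃t] at this
      refine this.trans ?_
      have h1 := trace_mul_re_nonneg (hρ x) (htest x).2
      rw [mul_sub, mul_one, Matrix.trace_sub, Complex.sub_re, htr] at h1
      nlinarith
  have hvar : ∀ V : X → Matrix B B ℂ, (∀ x, traceForm σ⁻¹ (V x) (V x) ≤ k) →
      ∑ C : Fin M → X, (∏ m, ρ.p (C m)) *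
        traceForm σ⁻¹ (deviation ρ.p V C) (deviation ρ.p V C) ≤ k / M := fun V hV => by
    refine (expect_bilin_mean_sub_le ρ.p_sum _ (traceForm_self_nonneg hB.inv.posSemidef) V hM).trans
      ?_
    have : ∑ x, ρ.p x * traceForm σ⁻¹ (V x) (V x) ≤ ∑ x, ρ.p x * k :=
      Finset.sum_le_sum fun x _ => mul_le_mul_of_nonneg_left (hV x) (ρ.p_nonneg x)
    rw [← Finset.sum_mul, ρ.p_sum, one_mul] at this
    rw [div_eq_inv_mul]
    gcongr
  -- A single optimal `U` for the whole deviation is paired with all three pieces. The adjoint on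
  -- the second is harmless because `U` is Hermitian and only real parts enter.
  have hpoint : ∀ C : Fin M → X, traceNorm (ρ.codebookState C - σ)
      ≤ (t ^ 2 + traceForm σ⁻¹ (deviation ρ.p V₁ C) (deviation ρ.p V₁ C)) / (2 * t)
        + (t ^ 2 + traceForm σ⁻¹ (deviation ρ.p V₂ C) (deviation ρ.p V₂ C)) / (2 * t)
        + ((M : ℝ)⁻¹ * ∑ m, (ρ.state (C m) * Q (C m)).trace.re
          + ∑ x, ρ.p x * (ρ.state x * Q x).trace.re) := by
    intro C
    have hsplit : deviation ρ.p ρ.state C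
        = deviation ρ.p V₁ C + (deviation ρ.p V₂ C)ᴴ + deviation ρ.p V₃ C := by
      simp only [deviation, hdec, Finset.sum_add_distrib, smul_add, Matrix.conjTranspose_sub,
        Matrix.conjTranspose_smul, Matrix.conjTranspose_sum, star_trivial]
      abel
    have hHh := isHermitian_codebookState_sub_marginalB ρ C
    rw [codebookState_sub_marginalB] at hHh ⊢
    obtain ⟨U, hU, hUU, hUn⟩ := exists_sign hHh
    rw [hUn, hsplit, mul_add, mul_add, Matrix.trace_add, Matrix.trace_add, Complex.add_re,
      Complex.add_re]
    have hS1 := trace_marginalB ρ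
    refine add_le_add (add_le_add ?_ ?_) ?_
    · rw [le_div_iff₀ (by positivity)]
      linarith [trace_unitary_mul_le hB hS1 hU hUU t (deviation ρ.p V₁ C)]
    · have hconj : (U * (deviation ρ.p V₂ C)ᴴ).trace.re = (U * deviation ρ.p V₂ C).trace.re := by
        have := congrArg Complex.re (Matrix.trace_conjTranspose (U * deviation ρ.p V₂ C))
        rwa [Matrix.conjTranspose_mul, hU.eq, Complex.star_def, Complex.conj_re,
          Matrix.trace_mul_comm] at this
      rw [hconj, le_div_iff₀ (by positivity)]
      linarith [trace_unitary_mul_le hB hS1 hU hUU t (deviation ρ.p V₂ C)]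
    · have hb : ∀ x, |(U * V₃ x).trace.re| ≤ (ρ.state x * Q x).trace.re := fun x => by
        rw [← hV₃t]; exact trace_unitary_mul_posSemidef_le hU hUU (hV₃p x)
      have e : (U * deviation ρ.p V₃ C).trace.re = (M : ℝ)⁻¹ * ∑ m, (U * V₃ (C m)).trace.re
          - ∑ x, ρ.p x * (U * V₃ x).trace.re := by
        simp [deviation, mul_sub, Matrix.mul_sum, Matrix.trace_sum]
      rw [e, sub_eq_add_neg, ← Finset.sum_neg_distrib]
      refine add_le_add (mul_le_mul_of_nonneg_left
        (Finset.sum_le_sum fun m _ => (abs_le.1 (hb _)).2) (by positivity))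
        (Finset.sum_le_sum fun x _ => ?_)
      rw [← mul_neg]
      exact mul_le_mul_of_nonneg_left (neg_le.1 (abs_le.1 (hb x)).1) (ρ.p_nonneg x)
  have htail : ∑ C : Fin M → X, (∏ m, ρ.p (C m)) *
      ((M : ℝ)⁻¹ * ∑ m, (ρ.state (C m) * Q (C m)).trace.re)
      = ∑ x, ρ.p x * (ρ.state x * Q x).trace.re := by
    have := expect_sum ρ.p_sum (fun x => (ρ.state x * Q x).trace.re) M
    simp only [smul_eq_mul] at this
    simp only [mul_left_comm _ (M : ℝ)⁻¹]
    rw [← Finset.mul_sum, this, ← mul_assoc, inv_mul_cancel₀ (by positivity), one_mul]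
  have hw := sum_prod_weight ρ.p_sum M
  -- In expectation the cut-off weight appears twice, from the codebook and from the mean, and the
  -- two variance terms add to `t + k / (t M)`; the factor `1 / 2` of the covering error halves
  -- both.
  have hsum := Finset.sum_le_sum fun (C : Fin M → X) (_ : C ∈ Finset.univ) =>
    mul_le_mul_of_nonneg_left (hpoint C) (prod_weight_nonneg ρ C)
  simp only [mul_add, Finset.sum_add_distrib, htail, add_div, mul_div_assoc', ← Finset.sum_div,
    ← Finset.sum_mul, hw, one_mul] at hsum
  have h1 := div_le_div_of_nonneg_right (hvar V₁ fun x => (hform x).1) (by positivity : 0 ≤ 2 * t)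
  have h2 := div_le_div_of_nonneg_right (hvar V₂ fun x => (hform x).2) (by positivity : 0 ≤ 2 * t)
  have e1 : t ^ 2 / (2 * t) = t / 2 := by field_simp
  have e2 : k / M / (2 * t) = k / (t * M) / 2 := by field_simp
  rw [e1] at hsum
  rw [e2] at h1 h2
  rw [CQState.coveringError]
  linarith

end Covering

/-! ### Upper bound on the covering number -/

section Achievability

variable {X B : Type*} [Fintype X] [Fintype B] [DecidableEq B]

theorem specCard_pos (ρ : CQState X B) : 0 < ρ.specCard := by
  have : Nonempty B := by
    by_contra h
    rw [not_nonempty_iff] at h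
    simpa [Matrix.trace] using trace_marginalB ρ
  have hfin : (spectrum ℂ ρ.marginalB).Finite := Matrix.finite_spectrum _
  exact (Set.ncard_pos hfin).2 (spectrum.nonempty_of_isAlgClosed_of_finiteDimensional ℂ _)

theorem coveringError_le_of_large (ρ : CQState X B) {ε δ c τ : ℝ} (hδ : 0 < δ)
    (hτ : τ ≤ ε - 3 * δ) {M : ℕ} (hM : 1 ≤ M)
    (herr : ∀ t : ℝ, 0 < t → ∀ M : ℕ, 1 ≤ M →
      ρ.coveringError M ≤ τ + (t + ρ.specCard * c / (t * M)) / 2)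
    (hMc : ρ.specCard * c / (9 * δ ^ 2) ≤ M) : M ∈ ρ.coveringSizes ε := by
  -- With `t = 3δ`, the size condition on `M` also makes the other variance term at most `3δ`.
  refine ⟨hM, (herr (3 * δ) (by positivity) M hM).trans ?_⟩
  have hM0 : (0 : ℝ) < M := by exact_mod_cast hM
  have : ρ.specCard * c / (3 * δ * M) ≤ 3 * δ := by
    rw [div_le_iff₀ (by positivity)] at hMc ⊢
    linarith
  linarith

variable [DecidableEq X]

/-- For every level `c` there is a test with weight `τ` under the joint state whose weight under
the product state is at most `τ / c`, such that the covering error is `τ` up to a variance term. -/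
theorem exists_cutoff_test (ρ : CQState X B) (hB : ρ.marginalB.PosDef) {c : ℝ} (hc : 0 < c) :
    ∃ T, IsTest T ∧ (ρ.joint * T).trace.re ≤ 1 ∧
      c * ((ρ.marginalX ⊗ₖ ρ.marginalB) * T).trace.re ≤ (ρ.joint * T).trace.re ∧
      c * (ρ.joint * T).trace.re ≤ Fintype.card X ∧
      ∀ t : ℝ, 0 < t → ∀ M : ℕ, 1 ≤ M →
        ρ.coveringError M ≤ (ρ.joint * T).trace.re + (t + ρ.specCard * c / (t * M)) / 2 := by
  have hρ := fun x => (ρ.state_density x).1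
  choose Q hQh hQQ hQ1 hQ2 using fun x =>
    exists_cutoff_projection (posSemidef_marginalB ρ) (hρ x) hc.le
  have hQt := fun x => isTest_of_projection (hQh x) (hQQ x)
  obtain ⟨T, hT, hTQ⟩ := exists_isTest_diagBlock hQt
  have hle : ∀ x, (ρ.state x * Q x).trace.re ≤ 1 := fun x => by
    have h1 := trace_mul_re_nonneg (hρ x) (hQt x).2
    rw [mul_sub, mul_one, Matrix.trace_sub, Complex.sub_re, (ρ.state_density x).2,
      Complex.one_re] at h1
    linarith
  have hj : (ρ.joint * T).trace.re = ∑ x, ρ.p x * (ρ.state x * Q x).trace.re := by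
    simp only [trace_joint_mul, hTQ]
  refine ⟨T, hT, ?_, ?_, ?_, fun t ht M hM => ?_⟩
  · rw [hj, ← ρ.p_sum]
    exact Finset.sum_le_sum fun x _ => mul_le_of_le_one_right (ρ.p_nonneg x) (hle x)
  · rw [hj, trace_product_mul, Finset.mul_sum]
    refine Finset.sum_le_sum fun x _ => ?_
    rw [hTQ, mul_left_comm]
    exact mul_le_mul_of_nonneg_left (hQ1 x) (ρ.p_nonneg x)
  -- Since `p(x) ρₓ ≤ σ`, each letter gives `c p(x) Tr[ρₓ Qₓ] ≤ c Tr[σ Qₓ] ≤ Tr[ρₓ Qₓ] ≤ 1`.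
  · have hx : ∀ x, c * (ρ.p x * (ρ.state x * Q x).trace.re) ≤ 1 := fun x => by
      have h1 : ρ.p x * (ρ.state x * Q x).trace.re ≤ (ρ.marginalB * Q x).trace.re := by
        simp only [CQState.marginalB, Finset.sum_mul, Matrix.trace_sum, Matrix.smul_mul,
          Matrix.trace_smul, Complex.re_sum, smul_eq_mul, Complex.re_ofReal_mul]
        exact Finset.single_le_sum (f := fun y => ρ.p y * (ρ.state y * Q x).trace.re)
          (fun y _ => mul_nonneg (ρ.p_nonneg y) (trace_mul_re_nonneg (hρ y) (hQt x).1))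
          (Finset.mem_univ x)
      exact (mul_le_mul_of_nonneg_left h1 hc.le).trans ((hQ1 x).trans (hle x))
    rw [hj, Finset.mul_sum]
    refine (Finset.sum_le_sum fun x _ => hx x).trans ?_
    simp
  · rw [hj]
    have hν : (0 : ℝ) < ρ.specCard := by exact_mod_cast specCard_pos ρ
    exact coveringError_le ρ hB Q hQh hQQ (mul_pos hν hc) hQ2 ht hM

/-- Independent of `I_h`, which may be infinite: at level `c = |X| / (ε - 3δ)` the bound `c τ ≤ |X|`
alone forces `τ ≤ ε - 3δ`. -/
theorem coveringSizes_nonempty (ρ : CQState X B) (hB : ρ.marginalB.PosDef) {ε δ : ℝ}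
    (hδ0 : 0 < δ) (hδ : 3 * δ < ε) : (ρ.coveringSizes ε).Nonempty := by
  have h0 : 0 < ε - 3 * δ := by linarith
  have hX : (0 : ℝ) < Fintype.card X := by
    have : Nonempty X := by
      by_contra h
      rw [not_nonempty_iff] at h
      simpa using ρ.p_sum
    exact_mod_cast Fintype.card_pos
  have hc : 0 < Fintype.card X / (ε - 3 * δ) := div_pos hX h0
  obtain ⟨T, -, -, -, hT, herr⟩ := exists_cutoff_test ρ hB hc
  have hτ : (ρ.joint * T).trace.re ≤ ε - 3 * δ := by
    rw [div_mul_eq_mul_div, div_le_iff₀ h0] at hT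
    exact le_of_mul_le_mul_left hT hX
  exact ⟨_, coveringError_le_of_large ρ hδ0 hτ (le_max_left 1 _) herr
    ((Nat.le_ceil _).trans (by exact_mod_cast le_max_right _ _))⟩

theorem neg_log_le_hypoDiv {n : Type*} [Fintype n] [DecidableEq n] {η : ℝ} {α β T : Matrix n n ℂ}
    (hT : IsTest T) (h : 1 - η ≤ (α * T).trace.re) :
    -ENNReal.log (ENNReal.ofReal (β * T).trace.re) ≤ hypoDiv η α β :=
  le_iSup₂ (f := fun (T : Matrix n n ℂ) (_ : IsTest T ∧ 1 - η ≤ (α * T).trace.re) =>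
    -ENNReal.log (ENNReal.ofReal (β * T).trace.re)) T ⟨hT, h⟩

/-- The trivial test `1` is admissible. This excludes the value `-∞` and later gives `exp I_h ≥ 1`.
-/
theorem zero_le_hypoInfo (ρ : CQState X B) {η : ℝ} (hη : 0 ≤ η) : 0 ≤ ρ.hypoInfo η := by
  have hd : ∀ x, diagBlock (1 : Matrix (X × B) (X × B) ℂ) x = 1 := fun x =>
    Matrix.submatrix_one _ (Prod.mk_right_injective x)
  have h1 : IsTest (1 : Matrix (X × B) (X × B) ℂ) :=
    ⟨Matrix.PosSemidef.one, by rw [sub_self]; exact Matrix.PosSemidef.zero⟩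
  refine le_trans (le_of_eq ?_) (neg_log_le_hypoDiv h1 ?_)
  · rw [trace_product_mul]
    simp [hd, trace_marginalB, ρ.p_sum]
  · rw [trace_joint_mul]
    simp [hd, (ρ.state_density _).2, ρ.p_sum, hη]

theorem log_coveringNumber_le (ρ : CQState X B) (hB : ρ.marginalB.PosDef) {ε δ : ℝ}
    (hε : ε < 1) (hδ0 : 0 < δ) (hδ : 3 * δ < ε) :
    (Real.log (ρ.coveringNumber ε) : EReal)
      ≤ ρ.hypoInfo (1 - ε + 3 * δ) + (Real.log ((ρ.specCard : ℝ) ^ 2 / δ ^ 4) : EReal) := by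
  have hI0 := zero_le_hypoInfo ρ (η := 1 - ε + 3 * δ) (by linarith)
  have hν : (1 : ℝ) ≤ ρ.specCard := by exact_mod_cast specCard_pos ρ
  rcases eq_or_ne (ρ.hypoInfo (1 - ε + 3 * δ)) ⊤ with htop | htop
  · rw [htop, EReal.top_add_coe]
    exact le_top
  · obtain ⟨r, hI⟩ : ∃ r : ℝ, ρ.hypoInfo (1 - ε + 3 * δ) = r :=
      ⟨_, (EReal.coe_toReal htop (ne_bot_of_le_ne_bot EReal.zero_ne_bot hI0)).symm⟩
    rw [hI] at hI0 ⊢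
    have hr : 0 ≤ r := by exact_mod_cast hI0
    have hy : 1 ≤ Real.exp r := Real.one_le_exp hr
    -- The factor `2` makes the contradiction strict: a test with `τ > ε - 3δ` would give `I_h ≥ r +
    -- log 2`.
    have hc : 0 < 2 * Real.exp r := by positivity
    obtain ⟨T, hT, hT1, hTc, -, herr⟩ := exists_cutoff_test ρ hB hc
    have hτ : (ρ.joint * T).trace.re ≤ ε - 3 * δ := by
      by_contra! hlt
      have h1 : -ENNReal.log (ENNReal.ofReal ((ρ.marginalX ⊗ₖ ρ.marginalB) * T).trace.re)
          ≤ (r : EReal) := by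
        rw [← hI]
        exact neg_log_le_hypoDiv hT (by linarith)
      have h2 : ((ρ.marginalX ⊗ₖ ρ.marginalB) * T).trace.re ≤ (2 * Real.exp r)⁻¹ := by
        rw [← one_div, le_div_iff₀ hc]; linarith
      have h3 := ENNReal.log_le_log (ENNReal.ofReal_le_ofReal h2)
      rw [ENNReal.log_ofReal_of_pos (inv_pos.2 hc), Real.log_inv, Real.log_mul two_ne_zero
        (Real.exp_ne_zero r), Real.log_exp] at h3
      have h4 := (EReal.neg_le_neg_iff.2 h3).trans h1
      have h5 : Real.log 2 + r ≤ r := by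
        rw [← EReal.coe_neg, neg_neg] at h4
        exact_mod_cast h4
      linarith [Real.log_pos one_lt_two]
    set K := ρ.specCard * (2 * Real.exp r) / (9 * δ ^ 2) with hK
    have hK0 : 0 < K := by positivity
    have hmem : ⌈K⌉₊ ∈ ρ.coveringSizes ε :=
      coveringError_le_of_large ρ hδ0 hτ (Nat.one_le_ceil_iff.2 hK0) herr (Nat.le_ceil _)
    have hN := Nat.sInf_le hmem
    have hN1 : 1 ≤ ρ.coveringNumber ε := (Nat.sInf_mem ⟨_, hmem⟩).1
    have hNK : (ρ.coveringNumber ε : ℝ) ≤ K + 1 :=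
      (by exact_mod_cast hN : (ρ.coveringNumber ε : ℝ) ≤ ⌈K⌉₊).trans (Nat.ceil_lt_add_one hK0.le).le
    -- The `+ 1` pays for rounding up; it and `K` are absorbed crudely using `δ < 1/3`, `ν ≥ 1` and
    -- `exp r ≥ 1`.
    have hfin : K + 1 ≤ Real.exp r * ((ρ.specCard : ℝ) ^ 2 / δ ^ 4) := by
      have hd2 : δ ^ 2 ≤ 1 / 9 := by nlinarith
      have hd4 : δ ^ 4 ≤ 1 := pow_le_one₀ hδ0.le (by linarith)
      have hνν : (ρ.specCard : ℝ) ≤ (ρ.specCard : ℝ) ^ 2 := by nlinarith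
      rw [← mul_div_assoc, le_div_iff₀ (by positivity)]
      have e : (K + 1) * δ ^ 4 = 2 / 9 * (ρ.specCard * Real.exp r) * δ ^ 2 + δ ^ 2 * δ ^ 2 := by
        rw [hK]; field_simp
      have h1 : 1 ≤ ρ.specCard * Real.exp r := one_le_mul_of_one_le_of_one_le hν hy
      have h2 : ρ.specCard * Real.exp r ≤ Real.exp r * (ρ.specCard : ℝ) ^ 2 := by
        rw [mul_comm]; gcongr
      rw [e]
      nlinarith [sq_nonneg δ]
    rw [← EReal.coe_add, EReal.coe_le_coe_iff]
    calc Real.log (ρ.coveringNumber ε)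
        ≤ Real.log (Real.exp r * ((ρ.specCard : ℝ) ^ 2 / δ ^ 4)) :=
          Real.log_le_log (by exact_mod_cast hN1) (hNK.trans hfin)
      _ = _ := by
          rw [Real.log_mul (Real.exp_ne_zero r) (by positivity), Real.log_exp]

end Achievability

/-! ### Lower bound on the covering number -/

section Converse

variable {X B : Type*} [Fintype X] [Fintype B] [DecidableEq B]

/-- Antitonicity of the inverse: both differences are Schur complements of the block matrix with
rows `(A, 1)` and `(1, G⁻¹)`. -/
theorem posSemidef_inv_sub_inv {A G : Matrix B B ℂ} (hA : A.PosDef) (hG : G.PosDef)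
    (h : (A - G).PosSemidef) : (G⁻¹ - A⁻¹).PosSemidef := by
  have := hA.isUnit.invertible
  have := hG.inv.isUnit.invertible
  have h1 := (Matrix.PosDef.fromBlocks₂₂ A 1 hG.inv).2 (by
    rwa [Matrix.nonsing_inv_nonsing_inv G ((Matrix.isUnit_iff_isUnit_det _).1 hG.isUnit), one_mul,
      Matrix.conjTranspose_one, mul_one])
  have h2 := (Matrix.PosDef.fromBlocks₁₁ 1 G⁻¹ hA).1 h1
  rwa [Matrix.conjTranspose_one, one_mul, mul_one] at h2

/-- A noncommutative union bound: the test `1 - a (S + a)⁻¹` with `S = ∑ T m` dominates every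
`(1 + a)⁻¹ T m` and is dominated by `a⁻¹ S`. -/
theorem exists_union_test {ι : Type*} [Fintype ι] [Nonempty ι] {T : ι → Matrix B B ℂ}
    (hT : ∀ m, IsTest (T m)) {a : ℝ} (ha : 0 < a) :
    ∃ L : Matrix B B ℂ, IsTest L ∧ (∀ m, (((1 + a : ℝ) : ℂ) • L - T m).PosSemidef) ∧
      (∑ m, T m - (a : ℂ) • L).PosSemidef := by
  have ha1 : (0 : ℂ) < a := by exact_mod_cast ha
  have ha2 : (0 : ℂ) ≤ (1 + a : ℝ) := by exact_mod_cast (by positivity : 0 ≤ 1 + a)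
  set S := ∑ m, T m with hS
  have hSp : S.PosSemidef := Matrix.posSemidef_sum _ fun m _ => (hT m).1
  have hone : ((a : ℂ) • (1 : Matrix B B ℂ)).PosDef := Matrix.PosDef.one.smul ha1
  have hpd : ∀ {A : Matrix B B ℂ}, A.PosSemidef → (A + (a : ℂ) • 1).PosDef :=
    fun h => hone.posSemidef_add h
  have hdet : ∀ {A : Matrix B B ℂ}, A.PosSemidef → IsUnit (A + (a : ℂ) • 1).det :=
    fun h => (Matrix.isUnit_iff_isUnit_det _).1 (hpd h).isUnit
  set L := 1 - (a : ℂ) • (S + (a : ℂ) • 1)⁻¹ with hL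
  have hlow : ∀ m, (((1 + a : ℝ) : ℂ) • L - T m).PosSemidef := fun m => by
    have hm := hT m
    set Y := T m with hY
    set G := (Y + (a : ℂ) • 1)⁻¹ with hG
    have h1 : (S - Y).PosSemidef := by
      classical
      rw [hS, ← Finset.sum_erase_eq_sub (Finset.mem_univ m)]
      exact Matrix.posSemidef_sum _ fun j _ => (hT j).1
    have h2 := posSemidef_inv_sub_inv (hpd hSp) (hpd hm.1) (by rwa [add_sub_add_right_eq_sub])
    -- For a scalar `y` this reads `(1 + a) y / (y + a) - y = y (1 - y) / (y + a) ≥ 0`. Positivity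
    -- is certified by writing `G (Y - Y²)` as a sum of congruences of `Y` and `1 - Y`.
    have h3 : (((1 + a : ℝ) : ℂ) • (1 - (a : ℂ) • G) - Y).PosSemidef := by
      have hGh : Gᴴ = G := (hpd hm.1).inv.1.eq
      have hYh : Yᴴ = Y := hm.1.1.eq
      have hGl : G * Y + (a : ℂ) • G = 1 := by
        have := Matrix.nonsing_inv_mul _ (hdet hm.1)
        rwa [mul_add, Matrix.mul_smul, mul_one] at this
      have hGr : Y * G + (a : ℂ) • G = 1 := by
        have := Matrix.mul_nonsing_inv _ (hdet hm.1)
        rwa [add_mul, Matrix.smul_mul, one_mul] at this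
      have p1 := hm.2.mul_mul_conjTranspose_same (G * Y)
      have p2 := ((hm.1.mul_mul_conjTranspose_same (1 - Y)).add
        (hm.2.mul_mul_conjTranspose_same Y)).mul_mul_conjTranspose_same G
      have p := p1.add (p2.smul ha1.le)
      rw [Matrix.conjTranspose_mul, Matrix.conjTranspose_sub, Matrix.conjTranspose_one, hGh,
        hYh] at p
      have c : Y * G = G * Y := by
        rw [← add_left_inj ((a : ℂ) • G), hGr, hGl]
      have e : Y = Y * Y * G + (a : ℂ) • (Y * G) := by
        have := congrArg (Y * ·) hGr
        simp only [mul_add, Matrix.mul_smul, mul_one, ← mul_assoc] at this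
        exact this.symm
      have lhs : ((1 + a : ℝ) : ℂ) • (1 - (a : ℂ) • G) - Y = G * (Y - Y * Y) := by
        have e1 : 1 - (a : ℂ) • G = G * Y := by rw [← hGl]; abel
        have e2 : Y = G * (Y * Y) + (a : ℂ) • (G * Y) := by
          nth_rewrite 1 [e]
          rw [c, mul_assoc, c, ← mul_assoc, c, mul_assoc]
        rw [e1]
        nth_rewrite 2 [e2]
        push_cast
        rw [mul_sub]
        module
      have rhs : G * Y * (1 - Y) * (Y * G) + (a : ℂ) • (G * ((1 - Y) * Y * (1 - Y) +
          Y * (1 - Y) * Y) * G) = G * (Y - Y * Y) := by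
        have e3 : (1 - Y) * Y * (1 - Y) + Y * (1 - Y) * Y = Y - Y * Y := by noncomm_ring
        have e4 : G * Y * (1 - Y) * (Y * G) = G * (Y - Y * Y) * (Y * G) := by
          simp only [mul_assoc, mul_sub, sub_mul, mul_one]
        rw [e3, e4, ← Matrix.mul_smul, ← mul_add, hGr, mul_one]
      rw [lhs, ← rhs]
      exact p
    have h4 := h3.add ((h2.smul ha1.le).smul ha2)
    convert h4 using 1
    rw [hL]
    module
  refine ⟨L, ⟨?_, ?_⟩, hlow, ?_⟩
  · obtain ⟨m⟩ := ‹Nonempty ι›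
    have h := ((hlow m).add (hT m).1).smul (inv_nonneg.2 ha2)
    have h0 : ((1 + a : ℝ) : ℂ) ≠ 0 := by exact_mod_cast (by positivity : (1 + a : ℝ) ≠ 0)
    rwa [sub_add_cancel, smul_smul, inv_mul_cancel₀ h0, one_smul] at h
  · rw [hL, sub_sub_cancel]
    exact (hpd hSp).inv.posSemidef.smul ha1.le
  -- `S - a L = S (S + a)⁻¹ S`.
  · have h := (hpd hSp).inv.posSemidef.mul_mul_conjTranspose_same S
    rw [hSp.1.eq] at h
    set W := (S + (a : ℂ) • 1)⁻¹ with hW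
    have h1 : S * W = 1 - (a : ℂ) • W := by
      have := Matrix.mul_nonsing_inv _ (hdet hSp)
      rw [add_mul, Matrix.smul_mul, one_mul] at this
      rw [← this]; abel
    have h2 : W * S = 1 - (a : ℂ) • W := by
      have := Matrix.nonsing_inv_mul _ (hdet hSp)
      rw [mul_add, Matrix.mul_smul, mul_one] at this
      rw [← this]; abel
    rwa [h1, sub_mul, one_mul, Matrix.smul_mul, h2] at h

variable [DecidableEq X]

/-- A test that separates the joint state from the product state forces the codebook of a good
covering to be large. -/
theorem test_sub_le_coveringError (ρ : CQState X B) {T : Matrix (X × B) (X × B) ℂ}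
    (hT : IsTest T) {a : ℝ} (ha : 0 < a) {M : ℕ} (hM : 1 ≤ M) :
    (ρ.joint * T).trace.re / (1 + a) - M * ((ρ.marginalX ⊗ₖ ρ.marginalB) * T).trace.re / a
      ≤ ρ.coveringError M := by
  have : NeZero M := ⟨by omega⟩
  set σ := ρ.marginalB with hσ
  have hρ := fun x => (ρ.state_density x).1
  have hpoint : ∀ C : Fin M → X,
      2 * ((M : ℝ)⁻¹ * (∑ m, (ρ.state (C m) * diagBlock T (C m)).trace.re) / (1 + a)
        - (∑ m, (σ * diagBlock T (C m)).trace.re) / a)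
      ≤ traceNorm (ρ.codebookState C - σ) := by
    intro C
    obtain ⟨L, hL, hL1, hL2⟩ := exists_union_test (fun m => isTest_diagBlock hT (C m)) ha
    refine le_trans ?_ (test_le_traceNorm (isHermitian_codebookState_sub_marginalB ρ C) hL)
    -- Both states have trace one, so the trace-norm bound reduces to `2 Tr[L (ρ_C - σ)]`.
    have htr : (ρ.codebookState C - σ).trace.re = 0 := by
      have hM0 : (M : ℂ) ≠ 0 := by exact_mod_cast (by omega : M ≠ 0)
      simp [CQState.codebookState, hσ, trace_marginalB, Matrix.trace_sum,
        (ρ.state_density _).2, hM0]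
    have h1 : ∀ m, (ρ.state (C m) * diagBlock T (C m)).trace.re / (1 + a)
        ≤ (L * ρ.state (C m)).trace.re := fun m => by
      have := trace_mul_re_nonneg (hρ (C m)) (hL1 m)
      rw [mul_sub, Matrix.trace_sub, Matrix.mul_smul, Matrix.trace_smul, Complex.sub_re,
        smul_eq_mul, Complex.re_ofReal_mul, Matrix.trace_mul_comm _ L] at this
      rw [div_le_iff₀ (by positivity)]
      linarith
    have h2 : (L * σ).trace.re ≤ (∑ m, (σ * diagBlock T (C m)).trace.re) / a := by
      have := trace_mul_re_nonneg (posSemidef_marginalB ρ) hL2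
      rw [mul_sub, Matrix.trace_sub, Matrix.mul_smul, Matrix.trace_smul, Complex.sub_re,
        smul_eq_mul, Complex.re_ofReal_mul, Matrix.trace_mul_comm _ L, Matrix.mul_sum,
        Matrix.trace_sum, Complex.re_sum] at this
      rw [le_div_iff₀ ha]
      linarith
    have h3 : (L * ρ.codebookState C).trace.re = (M : ℝ)⁻¹ * ∑ m, (L * ρ.state (C m)).trace.re := by
      rw [CQState.codebookState, Matrix.mul_smul, Matrix.trace_smul, Matrix.mul_sum,
        Matrix.trace_sum, smul_eq_mul, ← Complex.re_sum, ← Complex.re_ofReal_mul]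
      push_cast
      rfl
    have h4 := mul_le_mul_of_nonneg_left (Finset.sum_le_sum fun m (_ : m ∈ Finset.univ) => h1 m)
      (by positivity : (0 : ℝ) ≤ (M : ℝ)⁻¹)
    rw [← Finset.sum_div, ← mul_div_assoc] at h4
    rw [htr, mul_sub, mul_sub L, Matrix.trace_sub, Complex.sub_re, h3]
    linarith
  have hsum := Finset.sum_le_sum fun (C : Fin M → X) (_ : C ∈ Finset.univ) =>
    mul_le_mul_of_nonneg_left (hpoint C) (prod_weight_nonneg ρ C)
  have hM0 : (M : ℝ) ≠ 0 := by exact_mod_cast (by omega : M ≠ 0)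
  have e1 := expect_sum ρ.p_sum (fun x => (ρ.state x * diagBlock T x).trace.re) M
  have e2 := expect_sum ρ.p_sum (fun x => (σ * diagBlock T x).trace.re) M
  simp only [smul_eq_mul] at e1 e2
  rw [← trace_joint_mul] at e1
  rw [← trace_product_mul] at e2
  have e3 : ∑ C : Fin M → X, (∏ m, ρ.p (C m)) *
      (2 * ((M : ℝ)⁻¹ * (∑ m, (ρ.state (C m) * diagBlock T (C m)).trace.re) / (1 + a)
        - (∑ m, (σ * diagBlock T (C m)).trace.re) / a))
      = 2 * ((ρ.joint * T).trace.re / (1 + a)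
        - M * ((ρ.marginalX ⊗ₖ σ) * T).trace.re / a) := by
    calc _ = 2 * ((M : ℝ)⁻¹ * (∑ C : Fin M → X, (∏ m, ρ.p (C m)) *
            ∑ m, (ρ.state (C m) * diagBlock T (C m)).trace.re) / (1 + a)
          - (∑ C : Fin M → X, (∏ m, ρ.p (C m)) * ∑ m, (σ * diagBlock T (C m)).trace.re) / a) := by
          rw [Finset.mul_sum, Finset.sum_div, Finset.sum_div, ← Finset.sum_sub_distrib,
            Finset.mul_sum]
          exact Finset.sum_congr rfl fun C _ => by ring
      _ = _ := by rw [e1, e2, ← mul_assoc, inv_mul_cancel₀ hM0, one_mul]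
  rw [e3] at hsum
  rw [CQState.coveringError]
  linarith

theorem hypoInfo_sub_le_log (ρ : CQState X B) {ε δ c : ℝ} (hε1 : ε < 1) (hc : 0 < c)
    (hcδ : c < δ) (hδ : 3 * δ < ε) {M : ℕ} (hM : M ∈ ρ.coveringSizes ε) :
    ρ.hypoInfo (1 - ε - 2 * δ) - (Real.log ((1 + c) / (c * δ)) : EReal)
        - (Real.log ((ε + c) / (δ - c)) : EReal) ≤ (Real.log M : EReal) := by
  have hδ0 : 0 < δ := hc.trans hcδ
  have hε0 : 0 < ε := by linarith
  have hdc : 0 < δ - c := by linarith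
  have hM0 : (0 : ℝ) < M := by exact_mod_cast hM.1
  rw [EReal.sub_le_iff_le_add (by simp) (by simp), EReal.sub_le_iff_le_add (by simp) (by simp),
    ← EReal.coe_add, ← EReal.coe_add]
  refine iSup₂_le fun T hT => ?_
  have h1 := (test_sub_le_coveringError ρ hT.1 hc hM.1).trans hM.2
  set τ := ((ρ.marginalX ⊗ₖ ρ.marginalB) * T).trace.re with hτ
  have h2 : (ε + 2 * δ) / (1 + c) ≤ (ρ.joint * T).trace.re / (1 + c) := by
    gcongr
    linarith [hT.2]
  -- The left side of `h4` equals `(2δ - ε c) / (1 + c)`, which is at least `δ / (1 + c)` because `ε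
  -- c < c < δ`.
  have h3 : c * δ / (1 + c) ≤ M * τ := by
    have h4 : (ε + 2 * δ) / (1 + c) - ε ≤ M * τ / c := by linarith
    rw [le_div_iff₀ hc] at h4
    refine le_trans ?_ h4
    rw [div_le_iff₀ (by positivity)]
    have : ((ε + 2 * δ) / (1 + c) - ε) * c * (1 + c) = c * (2 * δ - ε * c) := by
      field_simp; ring
    rw [this]
    gcongr
    nlinarith
  have hlow : ((M * ((ε + c) / (δ - c)) * ((1 + c) / (c * δ)))⁻¹) ≤ τ := by
    -- The term `log ((ε + c) / (δ - c))` is nonnegative here, hence pure slack: `h7` already gives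
    -- the bound without it.
    have h5 : 1 ≤ (ε + c) / (δ - c) := by rw [le_div_iff₀ hdc]; linarith
    have h6 : (M * ((ε + c) / (δ - c)) * ((1 + c) / (c * δ)))⁻¹
        = (c * δ / (1 + c) / M) * ((ε + c) / (δ - c))⁻¹ := by
      have : ε + c ≠ 0 := by positivity
      field_simp
    have h7 : c * δ / (1 + c) / M ≤ τ := by
      rw [div_le_iff₀ hM0]; linarith
    rw [h6]
    exact (mul_le_of_le_one_right (by positivity) (inv_le_one_of_one_le₀ h5)).trans h7
  have hpos : 0 < (M * ((ε + c) / (δ - c)) * ((1 + c) / (c * δ)))⁻¹ := by positivity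
  rw [ENNReal.log_ofReal_of_pos (hpos.trans_le hlow), ← EReal.coe_neg, EReal.coe_le_coe_iff]
  have h8 := Real.log_le_log hpos hlow
  rw [Real.log_inv, Real.log_mul (by positivity) (by positivity),
    Real.log_mul (by positivity) (by positivity)] at h8
  linarith

end Converse

end SoftCovering

theorem theorem2 {X B : Type*} [Fintype X] [DecidableEq X] [Fintype B] [DecidableEq B]
    (ρ : SoftCovering.CQState X B) (hB : IsUnit ρ.marginalB)
    (ε δ c : ℝ) (hε0 : 0 < ε) (hε1 : ε < 1) (hc : 0 < c) (hcδ : c < δ)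
    (hδ : δ < min (ε / 3) ((1 - ε) / 2)) :
    (ρ.coveringSizes ε).Nonempty ∧
    ρ.hypoInfo (1 - ε - 2 * δ) - (Real.log ((1 + c) / (c * δ)) : EReal)
        - (Real.log ((ε + c) / (δ - c)) : EReal)
      ≤ (Real.log (ρ.coveringNumber ε) : EReal) ∧
    (Real.log (ρ.coveringNumber ε) : EReal)
      ≤ ρ.hypoInfo (1 - ε + 3 * δ) + (Real.log ((ρ.specCard : ℝ) ^ 2 / δ ^ 4) : EReal) := by
  have hpd : ρ.marginalB.PosDef :=
    (SoftCovering.posSemidef_marginalB ρ).posDef_iff_isUnit.2 hB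
  have h3 : 3 * δ < ε := by linarith [(lt_min_iff.1 hδ).1]
  have hδ0 : 0 < δ := hc.trans hcδ
  have hne := SoftCovering.coveringSizes_nonempty ρ hpd hδ0 h3
  exact ⟨hne, SoftCovering.hypoInfo_sub_le_log ρ hε1 hc hcδ h3 (Nat.sInf_mem hne),
    SoftCovering.log_coveringNumber_le ρ hpd hε1 hδ0 h3⟩
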